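/- Let $d\ge 3$, let $q_1,\dots,q_d$ be pairwise coprime positive integers, $\Gamma=q_1\mathbb Z\oplus\cdots\oplus q_d\mathbb Z$ and $Q=q_1q_2\cdots q_d$. For a $\Gamma$-periodic function $V:\mathbb Z^d\to\mathbb C$ and $k\in\mathbb R^d$, let $D_V(k)$ be the $Q\times Q$ matrix that represents $u\mapsto\Delta u+Vu$, where $(\Delta u)(n)=\sum_{\|n'-n\|_1=1}u(n')$, on the space of functions $u:\mathbb Z^d\to\mathbb C$ with $u(n+q_j\mathbf e_j)=e^{2\pi \mathbf i k_j}u(n)$ for $n\in\mathbb Z^d$, $1\le j\le d$ (identified with functions on $W=\{n\in\mathbb Z^d:0\le n_j\le q_j-1,\ 1\le j\le d\}$ by restriction), and put $P_V(k,\lambda)=\det(D_V(k)-\lambda I)$. For a non-empty set $S\subset\{1,\dots,d\}$, two such functions $V$ and $Y$ are called generalized partially Fermi isospectral with respect to $S$ if there exist $\lambda_1,\lambda_2\in\mathbb C$ and $k_j^*\in\mathbb R$ for each $j\in\{1,\dots,d\}\setminus S$ such that $P_V(k,\lambda_1)=P_Y(k,\lambda_2)$ for all $k\in\mathbb R^d$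 with $k_j=k_j^*$ for every $j\notin S$. A function $V$ on $\mathbb Z^d$ is called $(1,1,\dots,1)$-separable if there are functions $V_1,\dots,V_d:\mathbb Z\to\mathbb C$ with $V(n)=V_1(n_1)+\cdots+V_d(n_d)$ for all $n\in\mathbb Z^d$. Corollary. Let $V$ and $Y$ be real-valued $\Gamma$-periodic functions on $\mathbb Z^d$, and let $V$ be $(1,1,\dots,1)$-separable. Suppose that for all $1\le s<t\le d$ there is a set $S=S(s,t)\subset\{1,\dots,d\}$ with $s,t\in S$ and $\#S\ge 3$ such that $V$ and $Y$ are generalized partially Fermi isospectral with respect to $S$ (where $\lambda_1,\lambda_2$ and the $k_j^*$ may depend on $s,t$). Then $Y$ is also $(1,1,\dots,1)$-separable. -/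

import Mathlib

open scoped BigOperators

noncomputable section

namespace DiscreteSchrodinger

/-- `V : ℤᵈ → ℂ` is `Γ`-periodic for the lattice `Γ = q₁ℤ ⊕ ⋯ ⊕ q_dℤ`. -/
def IsPeriodic {d : ℕ} (q : Fin d → ℕ) (V : (Fin d → ℤ) → ℂ) : Prop :=
  ∀ (n : Fin d → ℤ) (j : Fin d), V (n + Pi.single j (q j : ℤ)) = V n

/-- The discrete Laplacian on `ℤᵈ`: the sum of `u` over the `2d` points at `ℓ¹`-distance `1`
from `n`, namely `n ± eⱼ`. -/
def laplacian {d : ℕ} (u : (Fin d → ℤ) → ℂ) (n : Fin d → ℤ) : ℂ :=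
  ∑ j : Fin d, (u (n + Pi.single j 1) + u (n - Pi.single j 1))

/-- The fundamental domain `W = {n : 0 ≤ nⱼ ≤ qⱼ - 1}` of `Γ`. It has `Q = q₁ ⋯ q_d` elements. -/
abbrev Cell {d : ℕ} (q : Fin d → ℕ) : Type := (j : Fin d) → Fin (q j)

/-- A point of the fundamental domain, seen as a point of `ℤᵈ`. -/
def Cell.toInt {d : ℕ} {q : Fin d → ℕ} (w : Cell q) : Fin d → ℤ := fun j => ((w j : ℕ) : ℤ)

/-- The function on `ℤᵈ` that satisfies the Floquet-Bloch boundary condition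
`u (n + qⱼ eⱼ) = exp (2πi kⱼ) u n` for all `j` and that is `1` at `w` and `0` at the other points
of the fundamental domain. For `w ∈ W` these functions are a basis of the space of all functions
with that boundary condition. -/
def blochBasis {d : ℕ} (q : Fin d → ℕ) (k : Fin d → ℝ) (w : Cell q) (n : Fin d → ℤ) : ℂ :=
  open Classical in
  if ∀ j, (q j : ℤ) ∣ n j - w.toInt j then
    Complex.exp (2 * Real.pi * Complex.I *
      ∑ j : Fin d, (k j : ℂ) * (((n j - w.toInt j) / (q j : ℤ) : ℤ) : ℂ))
  else 0

/-- The `Q × Q` matrix `D_V(k)` of `Δ + V` acting on the functions with the Floquet-Bloch boundary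
condition of quasimomentum `k`, in the basis `blochBasis q k`. -/
def floquetMatrix {d : ℕ} (q : Fin d → ℕ) (V : (Fin d → ℤ) → ℂ) (k : Fin d → ℝ) :
    Matrix (Cell q) (Cell q) ℂ :=
  Matrix.of fun w w' =>
    laplacian (blochBasis q k w') w.toInt + V w.toInt * blochBasis q k w' w.toInt

/-- `P_V(k, μ) = det (D_V(k) - μ I)`. -/
def floquetDet {d : ℕ} (q : Fin d → ℕ) (V : (Fin d → ℤ) → ℂ) (k : Fin d → ℝ) (μ : ℂ) : ℂ :=
  (floquetMatrix q V k - μ • (1 : Matrix (Cell q) (Cell q) ℂ)).det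

/-- `V` and `Y` are generalized partially Fermi isospectral with respect to the set `S` of
coordinates: for some energies `μ₁, μ₂` and some frozen quasimomenta `kⱼ*` (`j ∉ S`), the functions
`P_V(k, μ₁)` and `P_Y(k, μ₂)` agree for all real `kⱼ` (`j ∈ S`). Only the values of `kstar` outside
`S` matter. -/
def GenPartiallyFermiIsospectral {d : ℕ} (q : Fin d → ℕ) (S : Finset (Fin d))
    (V Y : (Fin d → ℤ) → ℂ) : Prop :=
  S.Nonempty ∧ ∃ (μ₁ μ₂ : ℂ) (kstar : Fin d → ℝ), ∀ k : Fin d → ℝ,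
    (∀ j, j ∉ S → k j = kstar j) → floquetDet q V k μ₁ = floquetDet q Y k μ₂

/-- `V` is `(1, 1, …, 1)`-separable: a sum of functions of one coordinate each. -/
def IsCompletelySeparable {d : ℕ} (V : (Fin d → ℤ) → ℂ) : Prop :=
  ∃ v : Fin d → ℤ → ℂ, ∀ n : Fin d → ℤ, V n = ∑ j : Fin d, v j (n j)

end DiscreteSchrodinger

end

open scoped BigOperators

noncomputable section

namespace DiscreteSchrodinger

/-! ### Auxiliary algebra, rigidity of roots of unity, and continuation from real points. -/

section Auxiliary

open Matrix Polynomial Filter Topology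

/-! In the basis of characters of `ℤᵈ / Γ`, twisted by complex multipliers `z`, the operator `Δ + V`
becomes a diagonal matrix of symbols plus the Fourier kernel of `V`
(`floquetDet_eq_det_dualMatrix`). A potential is completely separable when its Fourier coefficients
live on the coordinate axes, so the task is to kill the coefficients of `Y` at each `l` that is
nonzero in two directions `s`, `t`.

Pick a third free direction `r` and send the multipliers to infinity along a ray `τ z + u`, where
`z` is orthogonal to both `(1, 1, 1)` and the root-of-unity vector of `l` in the directions `s, t,
r`. By coprimality (`eq_one_or_eq_of_collinear_roots`), the symbol stays bounded exactly at the
frequencies agreeing with `0` or with `l` in these directions. After rescaling the unbounded rows,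
the determinant tends to that of `twoBlockMatrix`, and `u` leaves the spectral shifts `α`, `β` of
the two blocks free.

For separable `V` the blocks decouple. Equality for all `α`, `β` then forces `tr (E * B) = 0` for
the off-diagonal blocks of `Y` (`trace_mul_eq_zero_of_det_fromBlocks`). Since `Y` is real, `E` is
the adjoint of `B`, hence `B = 0`, and the coefficient at `l` is an entry of `B`. -/

theorem trace_eq_of_smul_det_eq {J : Type*} [Fintype J] [DecidableEq J] {X Y : Matrix J J ℂ}
    {c c' : ℂ} (hc : c ≠ 0)
    (h : ∀ β : ℂ, c * (β • (1 : Matrix J J ℂ) + X).det = c' * (β • (1 : Matrix J J ℂ) + Y).det) :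
    X.trace = Y.trace := by
  rcases isEmpty_or_nonempty J with hJ | hJ
  · simp [Matrix.trace]
  have key : ∀ Z : Matrix J J ℂ, ∀ β : ℂ,
      (β • (1 : Matrix J J ℂ) + Z).det = (-Z).charpoly.eval β := by
    intro Z β
    rw [Matrix.eval_charpoly, sub_neg_eq_add, Matrix.scalar_apply, Matrix.smul_one_eq_diagonal]
  have hp : C c * (-X).charpoly = C c' * (-Y).charpoly := by
    refine Polynomial.funext fun β => ?_
    simp only [eval_mul, eval_C, ← key, h]
  -- Both characteristic polynomials are monic, so the scalars agree; after cancelling them, the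
  -- subleading coefficients give the traces.
  have hlead : c = c' := by
    have := congrArg Polynomial.leadingCoeff hp
    simpa [leadingCoeff_mul, (Matrix.charpoly_monic _).leadingCoeff] using this
  subst hlead
  have hq := mul_left_cancel₀ (by simpa using hc) hp
  have h1 := Matrix.trace_eq_neg_charpoly_coeff (-X)
  have h2 := Matrix.trace_eq_neg_charpoly_coeff (-Y)
  rw [hq, ← h2] at h1
  simpa using h1

/-- Taking a Schur complement and comparing subleading coefficients in `β` gives `tr D - tr (E (α +
A)⁻¹ B) = tr D'`. The coefficient of `α⁻¹` as `α → ∞` is `tr (E * B)`. -/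
theorem trace_mul_eq_zero_of_det_fromBlocks {I J : Type*} [Fintype I] [DecidableEq I]
    [Fintype J] [DecidableEq J] {A A' : Matrix I I ℂ} {B : Matrix I J ℂ} {E : Matrix J I ℂ}
    {D D' : Matrix J J ℂ}
    (h : ∀ α β : ℂ, (fromBlocks (α • 1 + A) B E (β • 1 + D)).det =
      (fromBlocks (α • 1 + A') 0 0 (β • 1 + D')).det) :
    (E * B).trace = 0 := by
  have hcd : Continuous fun s : ℂ => (1 + s • A).det := by fun_prop
  have hct : Continuous fun s : ℂ => (E * (1 + s • A).adjugate * B).trace := by fun_prop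
  have hev : ∀ᶠ s : ℂ in 𝓝[≠] 0, (1 + s • A).det ≠ 0 := by
    refine (hcd.continuousAt.eventually_ne ?_).filter_mono nhdsWithin_le_nhds
    simp
  -- Here `s = α⁻¹`, and the adjugate clears the denominator so that both sides are continuous at `s
  -- = 0`.
  have hrel : ∀ᶠ s : ℂ in 𝓝[≠] 0, s * (E * (1 + s • A).adjugate * B).trace =
      (D.trace - D'.trace) * (1 + s • A).det := by
    filter_upwards [hev, self_mem_nhdsWithin] with s hs hs0
    have hs0 : s ≠ 0 := hs0
    have hfac : s⁻¹ • (1 : Matrix I I ℂ) + A = s⁻¹ • (1 + s • A) := by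
      rw [smul_add, smul_smul, inv_mul_cancel₀ hs0, one_smul]
    have hdet : (s⁻¹ • (1 : Matrix I I ℂ) + A).det ≠ 0 := by
      rw [hfac, det_smul]
      exact mul_ne_zero (pow_ne_zero _ (inv_ne_zero hs0)) hs
    have := Matrix.invertibleOfIsUnitDet (s⁻¹ • (1 : Matrix I I ℂ) + A) hdet.isUnit
    have htr := trace_eq_of_smul_det_eq (X := D - E * ⅟(s⁻¹ • (1 : Matrix I I ℂ) + A) * B)
      (Y := D') (c' := (s⁻¹ • (1 : Matrix I I ℂ) + A').det) hdet (fun β => by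
        have := h s⁻¹ β
        rw [det_fromBlocks₁₁, det_fromBlocks_zero₁₂] at this
        rw [← this, add_sub_assoc])
    have hinv : ⅟(s⁻¹ • (1 : Matrix I I ℂ) + A) =
        (s * ((1 + s • A).det)⁻¹) • (1 + s • A).adjugate := by
      rw [Matrix.invOf_eq_nonsing_inv]
      refine Matrix.inv_eq_right_inv ?_
      rw [hfac, Matrix.mul_smul, Matrix.smul_mul, Matrix.mul_adjugate, smul_smul, smul_smul]
      rw [show s * ((1 + s • A).det)⁻¹ * s⁻¹ * (1 + s • A).det = 1 by field_simp, one_smul]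
    rw [hinv, trace_sub, Matrix.mul_smul, Matrix.smul_mul, trace_smul, smul_eq_mul] at htr
    rw [← htr]
    field_simp
    ring
  have hc0 : D.trace - D'.trace = 0 := by
    have h1 : Tendsto (fun s : ℂ => s * (E * (1 + s • A).adjugate * B).trace) (𝓝[≠] 0) (𝓝 0) := by
      refine Tendsto.mono_left ?_ nhdsWithin_le_nhds
      exact Continuous.tendsto' (by fun_prop) 0 0 (by simp)
    have h2 : Tendsto (fun s : ℂ => (D.trace - D'.trace) * (1 + s • A).det) (𝓝[≠] 0)
        (𝓝 (D.trace - D'.trace)) := by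
      refine Tendsto.mono_left ?_ nhdsWithin_le_nhds
      exact Continuous.tendsto' (by fun_prop) 0 _ (by simp)
    exact tendsto_nhds_unique (h2.congr' (hrel.mono fun _ h => h.symm)) h1
  have h1 : Tendsto (fun s : ℂ => (E * (1 + s • A).adjugate * B).trace) (𝓝[≠] 0)
      (𝓝 (E * B).trace) := by
    have := (hct.tendsto 0).mono_left (nhdsWithin_le_nhds (s := {0}ᶜ))
    simpa using this
  refine tendsto_nhds_unique h1 (tendsto_const_nhds.congr' ?_)
  filter_upwards [hrel, self_mem_nhdsWithin] with s hs hs0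
  rw [hc0, zero_mul] at hs
  exact ((mul_eq_zero.mp hs).resolve_left hs0).symm

/-- An affine map of `ℂ` that sends three distinct points of the unit circle to the unit circle
is constant or a rotation about the origin. -/
theorem eq_or_rotation_of_collinear {x₁ x₂ x₃ y₁ y₂ y₃ : ℂ} (hx₁ : ‖x₁‖ = 1) (hx₂ : ‖x₂‖ = 1)
    (hx₃ : ‖x₃‖ = 1) (hy₁ : ‖y₁‖ = 1) (hy₂ : ‖y₂‖ = 1) (hy₃ : ‖y₃‖ = 1)
    (h12 : x₁ ≠ x₂) (h13 : x₁ ≠ x₃) (h23 : x₂ ≠ x₃)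
    (h : y₁ * (x₃ - x₂) + y₂ * (x₁ - x₃) + y₃ * (x₂ - x₁) = 0) :
    (y₁ = y₂ ∧ y₁ = y₃) ∨ ∃ a : ℂ, y₁ = a * x₁ ∧ y₂ = a * x₂ ∧ y₃ = a * x₃ := by
  have h21 : x₂ - x₁ ≠ 0 := sub_ne_zero.mpr h12.symm
  obtain ⟨a, ha⟩ : ∃ a, a * (x₂ - x₁) = y₂ - y₁ := ⟨(y₂ - y₁) / (x₂ - x₁), by field_simp⟩
  obtain ⟨b, hb⟩ : ∃ b, b = y₁ - a * x₁ := ⟨_, rfl⟩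
  have e1 : y₁ = a * x₁ + b := by rw [hb]; ring
  have e2 : y₂ = a * x₂ + b := by rw [hb]; linear_combination -ha
  have e3 : y₃ = a * x₃ + b := by
    refine mul_right_cancel₀ h21 ?_
    rw [hb]
    linear_combination h - (x₃ - x₁) * ha
  -- On the unit circle conjugation is inversion, so `‖a * x + b‖ = 1` becomes a quadratic equation
  -- in `x`. Three distinct roots force its leading coefficient `a * star b` to vanish.
  have key : ∀ x y : ℂ, ‖x‖ = 1 → ‖y‖ = 1 → y = a * x + b →
      a * star b * x ^ 2 + (a * star a + b * star b - 1) * x + star a * b = 0 := by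
    intro x y hx hy hxy
    have hx' : x * star x = 1 := by
      simpa [hx] using Complex.mul_conj' x
    have hy' : y * star y = 1 := by
      simpa [hy] using Complex.mul_conj' y
    rw [hxy, star_add, star_mul'] at hy'
    linear_combination x * hy' - (x * a * star a + star a * b) * hx'
  have k1 := key x₁ y₁ hx₁ hy₁ e1
  have k2 := key x₂ y₂ hx₂ hy₂ e2
  have k3 := key x₃ y₃ hx₃ hy₃ e3
  have m1 : a * star b * (x₁ + x₂) + (a * star a + b * star b - 1) = 0 := by
    refine (mul_eq_zero.mp ?_).resolve_left (sub_ne_zero.mpr h12)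
    linear_combination k1 - k2
  have m2 : a * star b * (x₁ + x₃) + (a * star a + b * star b - 1) = 0 := by
    refine (mul_eq_zero.mp ?_).resolve_left (sub_ne_zero.mpr h13)
    linear_combination k1 - k3
  have m3 : a * star b = 0 := by
    refine (mul_eq_zero.mp ?_).resolve_right (sub_ne_zero.mpr h23)
    linear_combination m1 - m2
  rcases mul_eq_zero.mp m3 with h0 | h0
  · left
    simp only [e1, e2, e3, h0, zero_mul, and_self]
  · right
    rw [star_eq_zero] at h0
    exact ⟨a, by simpa [h0] using e1, by simpa [h0] using e2, by simpa [h0] using e3⟩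

theorem eq_one_of_pow_eq_one_of_coprime {m n : ℕ} (h : m.Coprime n) {a : ℂ} (hm : a ^ m = 1)
    (hn : a ^ n = 1) : a = 1 := by
  have := pow_gcd_eq_one.mpr ⟨hm, hn⟩
  rwa [h, pow_one] at this

/-- The linear forms `z ↦ ∑ yᵢ zᵢ`, where `yᵢ` are roots of unity of pairwise coprime orders, that
vanish on the common kernel of `z ↦ ∑ zᵢ` and `z ↦ ∑ xᵢ zᵢ`. -/
theorem eq_one_or_eq_of_collinear_roots {q₁ q₂ q₃ : ℕ} (h1 : 0 < q₁) (h2 : 0 < q₂) (h3 : 0 < q₃)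
    (c12 : q₁.Coprime q₂)
    {x₁ x₂ x₃ y₁ y₂ y₃ : ℂ} (hx₁ : x₁ ^ q₁ = 1) (hx₂ : x₂ ^ q₂ = 1)
    (hx₃ : x₃ ^ q₃ = 1) (hy₁ : y₁ ^ q₁ = 1) (hy₂ : y₂ ^ q₂ = 1) (hy₃ : y₃ ^ q₃ = 1)
    (h12 : x₁ ≠ x₂) (h13 : x₁ ≠ x₃) (h23 : x₂ ≠ x₃)
    (h : y₁ * (x₃ - x₂) + y₂ * (x₁ - x₃) + y₃ * (x₂ - x₁) = 0) :
    (y₁ = 1 ∧ y₂ = 1 ∧ y₃ = 1) ∨ (y₁ = x₁ ∧ y₂ = x₂ ∧ y₃ = x₃) := by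
  have nz : ∀ {m : ℕ} {x : ℂ}, 0 < m → x ^ m = 1 → ‖x‖ = 1 := fun hm hx =>
    Complex.norm_eq_one_of_pow_eq_one hx hm.ne'
  rcases eq_or_rotation_of_collinear (nz h1 hx₁) (nz h2 hx₂) (nz h3 hx₃) (nz h1 hy₁) (nz h2 hy₂)
    (nz h3 hy₃) h12 h13 h23 h with ⟨e, e'⟩ | ⟨a, e1, e2, e3⟩
  · left
    have : y₁ = 1 := eq_one_of_pow_eq_one_of_coprime c12 hy₁ (e ▸ hy₂)
    exact ⟨this, e ▸ this, e' ▸ this⟩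
  · right
    have ha : a = 1 := by
      refine eq_one_of_pow_eq_one_of_coprime c12 ?_ ?_
      · rwa [e1, mul_pow, hx₁, mul_one] at hy₁
      · rwa [e2, mul_pow, hx₂, mul_one] at hy₂
    simp [e1, e2, e3, ha]

/-- A separately entire function that vanishes at the real points of a coordinate subspace vanishes
on its complexification. -/
theorem eq_zero_of_eq_zero_on_real {ι : Type*} [DecidableEq ι] (S : Finset ι)
    (f : (ι → ℂ) → ℂ)
    (hf : ∀ x j, Differentiable ℂ fun w => f (Function.update x j w)) (a : ι → ℝ)
    (h0 : ∀ k : ι → ℝ, (∀ j, j ∉ S → k j = a j) → f (fun j => (k j : ℂ)) = 0)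
    (x : ι → ℂ) (hx : ∀ j, j ∉ S → x j = a j) : f x = 0 := by
  -- `T` collects the coordinates allowed to be non-real; they are released one at a time by the
  -- identity theorem in one variable.
  suffices H : ∀ T : Finset ι, ∀ x : ι → ℂ, (∀ j, j ∉ S → x j = a j) →
      (∀ j, j ∉ T → ((x j).re : ℂ) = x j) → f x = 0 by
    exact H S x hx fun j hj => by rw [hx j hj, Complex.ofReal_re]
  intro T
  induction T using Finset.induction_on with
  | empty =>
    intro x hx hT
    have := h0 (fun j => (x j).re) (fun j hj => by rw [hx j hj, Complex.ofReal_re])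
    rwa [funext fun j => hT j (Finset.notMem_empty j)] at this
  | insert i T hi ih =>
    intro x hx hT
    by_cases hiS : i ∈ S
    · have hreal : ∀ r : ℝ, f (Function.update x i (r : ℂ)) = 0 := by
        intro r
        refine ih _ (fun j hj => ?_) (fun j hj => ?_)
        · rw [Function.update_of_ne (by rintro rfl; exact hj hiS), hx j hj]
        · by_cases hji : j = i
          · subst hji; simp
          · rw [Function.update_of_ne hji]
            exact hT j (by simp [hji, hj])
      have han : AnalyticOnNhd ℂ (fun w => f (Function.update x i w)) Set.univ :=
        fun w _ => (hf x i).analyticAt w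
      have hfreq : ∃ᶠ w in 𝓝[≠] (0 : ℂ), f (Function.update x i w) = 0 := by
        have ht : Tendsto (fun r : ℝ => (r : ℂ)) (𝓝[≠] 0) (𝓝[≠] 0) := by
          refine tendsto_nhdsWithin_iff.mpr ⟨?_, ?_⟩
          · exact (Complex.continuous_ofReal.tendsto' 0 0 (by simp)).mono_left nhdsWithin_le_nhds
          · filter_upwards [self_mem_nhdsWithin] with r hr
            simpa using hr
        exact ht.frequently (Frequently.of_forall hreal)
      have := han.eqOn_zero_of_preconnected_of_frequently_eq_zero isPreconnected_univ
        (Set.mem_univ 0) hfreq (Set.mem_univ (x i))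
      simpa using this
    · refine ih x hx fun j hj => ?_
      by_cases hji : j = i
      · subst hji; rw [hx j hiS, Complex.ofReal_re]
      · exact hT j (by simp [hji, hj])

end Auxiliary

/-! ### Decoupling of two blocks. -/

/-- The matrix with rows `(α + cᵢ) eᵢ + Kᵢ` for `i` in `a`, `(β + cᵢ) eᵢ + Kᵢ` for `i` in `b` and
`γᵢ eᵢ` for the other `i`. -/
def twoBlockMatrix {ι : Type*} [DecidableEq ι] (a b : ι → Prop) [DecidablePred a]
    [DecidablePred b] (γ c : ι → ℂ) (K : Matrix ι ι ℂ) (α β : ℂ) : Matrix ι ι ℂ :=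
  Matrix.of fun i j =>
    if a i then (if i = j then α + c i else 0) + K i j
    else if b i then (if i = j then β + c i else 0) + K i j
    else if i = j then γ i else 0

-- The rows outside the two blocks contribute the same nonzero factor on both sides. What remains is
-- a two-by-two block identity, where the trace is that of `Bᴴ * B` because `K` is Hermitian.
open scoped ComplexOrder in
theorem eq_zero_of_det_twoBlockMatrix_eq {ι : Type*} [Fintype ι] [DecidableEq ι] {a b : ι → Prop}
    [DecidablePred a] [DecidablePred b] (hab : ∀ i, a i → ¬ b i) {γ c c' : ι → ℂ}
    (hγ : ∀ i, ¬ a i → ¬ b i → γ i ≠ 0) {K K' : Matrix ι ι ℂ}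
    (hK : ∀ i j, star (K i j) = K j i)
    (hK' : ∀ i j, a i → b j → K' i j = 0) (hK'' : ∀ i j, b i → a j → K' i j = 0)
    (h : ∀ α β, (twoBlockMatrix a b γ c K α β).det = (twoBlockMatrix a b γ c' K' α β).det)
    {i j : ι} (hi : a i) (hj : b j) : K i j = 0 := by
  have hdisj : Disjoint a b := Pi.disjoint_iff.mpr fun i => by
    rw [Prop.disjoint_iff]
    exact fun h => hab i h.1 h.2
  let e : {i // a i} ⊕ {i // b i} ≃ {i // a i ∨ b i} := (subtypeOrEquiv a b hdisj).symm
  have hdet : ∀ (c : ι → ℂ) (K : Matrix ι ι ℂ) α β, (twoBlockMatrix a b γ c K α β).det =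
      (Matrix.fromBlocks
        (α • 1 + (Matrix.diagonal c + K).submatrix (Subtype.val : {i // a i} → ι) Subtype.val)
        (K.submatrix (Subtype.val : {i // a i} → ι) (Subtype.val : {i // b i} → ι))
        (K.submatrix (Subtype.val : {i // b i} → ι) (Subtype.val : {i // a i} → ι))
        (β • 1 + (Matrix.diagonal c + K).submatrix (Subtype.val : {i // b i} → ι)
          Subtype.val)).det *
      ∏ i : {i // ¬ (a i ∨ b i)}, γ i := by
    intro c K α β
    rw [Matrix.twoBlockTriangular_det _ (fun i => a i ∨ b i)]
    · congr 1
      · rw [← Matrix.det_submatrix_equiv_self e]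
        congr 1
        ext (⟨i, hi⟩ | ⟨i, hi⟩) (⟨j, hj⟩ | ⟨j, hj⟩)
        · by_cases hij : i = j
          · subst hij
            simp [e, Matrix.toSquareBlockProp, twoBlockMatrix, hi, add_assoc]
          · simp [e, Matrix.toSquareBlockProp, twoBlockMatrix, hi, hij]
        · have hij : i ≠ j := by rintro rfl; exact hab i hi hj
          simp [e, Matrix.toSquareBlockProp, twoBlockMatrix, hi, hij]
        · have hij : i ≠ j := by rintro rfl; exact hab i hj hi
          have hi' : ¬ a i := fun h => hab i h hi
          simp [e, Matrix.toSquareBlockProp, twoBlockMatrix, hi, hi', hij]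
        · have hi' : ¬ a i := fun h => hab i h hi
          by_cases hij : i = j
          · subst hij
            simp [e, Matrix.toSquareBlockProp, twoBlockMatrix, hi, hi', add_assoc]
          · simp [e, Matrix.toSquareBlockProp, twoBlockMatrix, hi, hi', hij]
      · rw [← Matrix.det_diagonal]
        congr 1
        ext ⟨i, hi⟩ ⟨j, hj⟩
        have hi' := not_or.mp hi
        simp [Matrix.toSquareBlockProp, twoBlockMatrix, hi', Matrix.diagonal_apply]
    · intro i hi j hj
      have hi' := not_or.mp hi
      have hij : i ≠ j := by rintro rfl; exact hi hj
      simp [twoBlockMatrix, hi', hij]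
  have hprod : ∏ i : {i // ¬ (a i ∨ b i)}, γ i ≠ 0 :=
    Finset.prod_ne_zero_iff.mpr fun i _ => hγ i (not_or.mp i.2).1 (not_or.mp i.2).2
  have h0 : K'.submatrix (Subtype.val : {i // a i} → ι) (Subtype.val : {i // b i} → ι) = 0 := by
    ext i j
    exact hK' i j i.2 j.2
  have h0' : K'.submatrix (Subtype.val : {i // b i} → ι) (Subtype.val : {i // a i} → ι) = 0 := by
    ext i j
    exact hK'' i j i.2 j.2
  have hcancel := fun α β => mul_right_cancel₀ hprod
    ((hdet c K α β).symm.trans ((h α β).trans (hdet c' K' α β)))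
  rw [h0, h0'] at hcancel
  have htr := trace_mul_eq_zero_of_det_fromBlocks hcancel
  have hstar : K.submatrix (Subtype.val : {i // b i} → ι) (Subtype.val : {i // a i} → ι) =
      (K.submatrix (Subtype.val : {i // a i} → ι) (Subtype.val : {i // b i} → ι)).conjTranspose := by
    ext i j
    exact (hK j i).symm
  rw [hstar, Matrix.trace_conjTranspose_mul_self_eq_zero_iff] at htr
  exact congrFun (congrFun htr ⟨i, hi⟩) ⟨j, hj⟩

/-! ### Fourier analysis on `ℤᵈ / Γ`. -/

open Filter Topology

/-- The primitive `m`-th root of unity `exp (2πi / m)`. -/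
def rootUnit (m : ℕ) : ℂ := Complex.exp (2 * Real.pi * Complex.I / m)

theorem rootUnit_ne_zero (m : ℕ) : rootUnit m ≠ 0 := Complex.exp_ne_zero _

theorem isPrimitiveRoot_rootUnit {m : ℕ} (hm : 0 < m) : IsPrimitiveRoot (rootUnit m) m :=
  Complex.isPrimitiveRoot_exp m hm.ne'

theorem rootUnit_zpow_pow {m : ℕ} (hm : 0 < m) (b : ℤ) : (rootUnit m ^ b) ^ m = 1 := by
  rw [← zpow_natCast, ← zpow_mul, mul_comm, zpow_mul, zpow_natCast,
    (isPrimitiveRoot_rootUnit hm).pow_eq_one, one_zpow]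

theorem sum_rootUnit_zpow {m : ℕ} (hm : 0 < m) (b : ℤ) :
    ∑ a : Fin m, rootUnit m ^ (((a : ℕ) : ℤ) * b) = if (m : ℤ) ∣ b then (m : ℂ) else 0 := by
  have h := isPrimitiveRoot_rootUnit hm
  have h1 : ∀ a : Fin m, rootUnit m ^ (((a : ℕ) : ℤ) * b) = (rootUnit m ^ b) ^ (a : ℕ) := by
    intro a
    rw [mul_comm, zpow_mul, zpow_natCast]
  simp only [h1]
  rw [Fin.sum_univ_eq_sum_range (fun i => (rootUnit m ^ b) ^ i) m]
  split_ifs with hb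
  · simp [(h.zpow_eq_one_iff_dvd b).mpr hb]
  · have hne : rootUnit m ^ b - 1 ≠ 0 := sub_ne_zero.mpr fun e => hb ((h.zpow_eq_one_iff_dvd b).mp e)
    refine (mul_eq_zero.mp ?_).resolve_right hne
    rw [geom_sum_mul, rootUnit_zpow_pow hm, sub_self]

variable {d : ℕ} {q : Fin d → ℕ}

/-- The character `n ↦ ∏ exp (2πi lⱼ nⱼ / qⱼ)` of `ℤᵈ / Γ`. -/
def wave (q : Fin d → ℕ) (l : Cell q) (n : Fin d → ℤ) : ℂ :=
  ∏ j, rootUnit (q j) ^ (l.toInt j * n j)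

theorem sum_cell_prod (g : (j : Fin d) → Fin (q j) → ℂ) :
    ∑ w : Cell q, ∏ j, g j (w j) = ∏ j, ∑ a, g j a := by
  rw [Finset.prod_univ_sum, Fintype.piFinset_univ]

theorem dvd_toInt_sub_iff {l l' : Cell q} (j : Fin d) :
    (q j : ℤ) ∣ l.toInt j - l'.toInt j ↔ l j = l' j := by
  constructor
  · intro h
    have h1 := (l j).isLt
    have h2 := (l' j).isLt
    have := Int.eq_zero_of_abs_lt_dvd h (by simp only [Cell.toInt]; rw [abs_lt]; omega)
    simp only [Cell.toInt] at this
    ext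
    omega
  · intro h
    simp [Cell.toInt, h]

theorem sum_wave_mul_inv (hq : ∀ j, 0 < q j) (n m : Fin d → ℤ) :
    ∑ l : Cell q, wave q l n * (wave q l m)⁻¹ =
      if ∀ j, (q j : ℤ) ∣ n j - m j then ∏ j, (q j : ℂ) else 0 := by
  have h : ∀ l : Cell q, wave q l n * (wave q l m)⁻¹ =
      ∏ j, rootUnit (q j) ^ (((l j : ℕ) : ℤ) * (n j - m j)) := by
    intro l
    rw [wave, wave, ← Finset.prod_inv_distrib, ← Finset.prod_mul_distrib]
    refine Finset.prod_congr rfl fun j _ => ?_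
    rw [mul_sub, zpow_sub₀ (rootUnit_ne_zero _), div_eq_mul_inv]
    rfl
  simp only [h]
  rw [sum_cell_prod fun j (a : Fin (q j)) => rootUnit (q j) ^ (((a : ℕ) : ℤ) * (n j - m j))]
  simp only [sum_rootUnit_zpow (hq _)]
  split_ifs with hd
  · exact Finset.prod_congr rfl fun j _ => if_pos (hd j)
  · obtain ⟨j, hj⟩ := not_forall.mp hd
    exact Finset.prod_eq_zero (Finset.mem_univ j) (if_neg hj)

theorem wave_mul_inv_eq (l l' w : Cell q) : wave q l' w.toInt * (wave q l w.toInt)⁻¹ =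
    ∏ j, rootUnit (q j) ^ (((w j : ℕ) : ℤ) * (l'.toInt j - l.toInt j)) := by
  rw [wave, wave, ← Finset.prod_inv_distrib, ← Finset.prod_mul_distrib]
  refine Finset.prod_congr rfl fun j _ => ?_
  rw [mul_sub, zpow_sub₀ (rootUnit_ne_zero _), div_eq_mul_inv, mul_comm (l'.toInt j),
    mul_comm (l.toInt j)]
  rfl

/-- The matrix of the multiplication operator by `V` in the basis of characters. -/
def fourierKernel (q : Fin d → ℕ) (V : (Fin d → ℤ) → ℂ) : Matrix (Cell q) (Cell q) ℂ :=
  Matrix.of fun l l' =>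
    (∏ j, (q j : ℂ))⁻¹ * ∑ w : Cell q, V w.toInt * (wave q l' w.toInt * (wave q l w.toInt)⁻¹)

theorem prod_period_ne_zero (hq : ∀ j, 0 < q j) : (∏ j, (q j : ℂ)) ≠ 0 :=
  Finset.prod_ne_zero_iff.mpr fun j _ => Nat.cast_ne_zero.mpr (hq j).ne'

theorem toInt_dvd_iff (w v : Cell q) :
    (∀ j, (q j : ℤ) ∣ w.toInt j - v.toInt j) ↔ w = v := by
  simp only [dvd_toInt_sub_iff, funext_iff]

/-- Fourier inversion on the fundamental domain. -/
theorem sum_wave_mul_fourierKernel (hq : ∀ j, 0 < q j) (V : (Fin d → ℤ) → ℂ) (w l : Cell q) :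
    ∑ l', wave q l' w.toInt * fourierKernel q V l' l = V w.toInt * wave q l w.toInt := by
  have hQ := prod_period_ne_zero hq
  calc ∑ l', wave q l' w.toInt * fourierKernel q V l' l
      = (∏ j, (q j : ℂ))⁻¹ * ∑ v : Cell q, V v.toInt * wave q l v.toInt *
          ∑ l' : Cell q, wave q l' w.toInt * (wave q l' v.toInt)⁻¹ := by
        simp only [fourierKernel, Matrix.of_apply, Finset.mul_sum]
        rw [Finset.sum_comm]
        refine Finset.sum_congr rfl fun v _ => Finset.sum_congr rfl fun l' _ => ?_
        ring
    _ = V w.toInt * wave q l w.toInt := by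
        simp only [sum_wave_mul_inv hq, toInt_dvd_iff]
        simp only [mul_ite, mul_zero, Finset.sum_ite_eq, Finset.mem_univ, if_true]
        field_simp

theorem star_rootUnit_zpow {m : ℕ} (hm : 0 < m) (b : ℤ) :
    star (rootUnit m ^ b) = (rootUnit m ^ b)⁻¹ := by
  have h : ‖rootUnit m ^ b‖ = 1 := by
    rw [norm_zpow, (isPrimitiveRoot_rootUnit hm).norm'_eq_one hm.ne', one_zpow]
  rw [Complex.inv_eq_conj h]
  rfl

theorem fourierKernel_isHermitian (hq : ∀ j, 0 < q j) {V : (Fin d → ℤ) → ℂ}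
    (hV : ∀ n, (V n).im = 0) (l l' : Cell q) :
    star (fourierKernel q V l l') = fourierKernel q V l' l := by
  have hw : ∀ (l : Cell q) n, star (wave q l n) = (wave q l n)⁻¹ := by
    intro l n
    simp only [wave, star_prod, star_rootUnit_zpow (hq _), Finset.prod_inv_distrib]
  have hV' : ∀ n, star (V n) = V n := fun n => Complex.conj_eq_iff_im.mpr (hV n)
  have hQ : star (∏ j, (q j : ℂ)) = ∏ j, (q j : ℂ) := by
    rw [star_prod]; exact Finset.prod_congr rfl fun j _ => Complex.conj_natCast _
  simp only [fourierKernel, Matrix.of_apply, star_mul', star_sum, star_inv₀, hw, hV', hQ, inv_inv]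
  congr 1
  refine Finset.sum_congr rfl fun w _ => ?_
  ring

/-- The Fourier coefficients of a completely separable function live on the coordinate axes. -/
theorem IsCompletelySeparable.fourierKernel_eq_zero (hq : ∀ j, 0 < q j) {V : (Fin d → ℤ) → ℂ}
    (hV : IsCompletelySeparable V) {l l' : Cell q} {s t : Fin d} (hst : s ≠ t)
    (hs : l s ≠ l' s) (ht : l t ≠ l' t) : fourierKernel q V l l' = 0 := by
  obtain ⟨v, hv⟩ := hV
  have hz : ∀ i, l i ≠ l' i →
      ∑ a : Fin (q i), rootUnit (q i) ^ (((a : ℕ) : ℤ) * (l'.toInt i - l.toInt i)) = 0 := by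
    intro i hi
    rw [sum_rootUnit_zpow (hq i), if_neg]
    rw [dvd_toInt_sub_iff]
    exact hi.symm
  simp only [fourierKernel, Matrix.of_apply, hv, Finset.sum_mul]
  rw [Finset.sum_comm, Finset.sum_eq_zero, mul_zero]
  intro j _
  -- The summand `v j` depends on one coordinate only, so one of `s`, `t` is left with a full sum of
  -- a nontrivial character.
  obtain ⟨i, hij, hi⟩ : ∃ i, i ≠ j ∧ l i ≠ l' i := by
    by_cases h : s = j
    · exact ⟨t, fun e => hst (h.trans e.symm), ht⟩
    · exact ⟨s, h, hs⟩
  have hprod : ∀ w : Cell q, v j (w.toInt j) * (wave q l' w.toInt * (wave q l w.toInt)⁻¹) =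
      ∏ i, (fun (i : Fin d) (a : Fin (q i)) => (if i = j then v j ((a : ℕ) : ℤ) else 1) *
        rootUnit (q i) ^ (((a : ℕ) : ℤ) * (l'.toInt i - l.toInt i))) i (w i) := by
    intro w
    rw [Finset.prod_mul_distrib, ← wave_mul_inv_eq,
      Finset.prod_eq_single j (fun i _ h => if_neg h) (by simp), if_pos rfl]
    rfl
  simp only [hprod]
  rw [sum_cell_prod (fun (i : Fin d) (a : Fin (q i)) => (if i = j then v j ((a : ℕ) : ℤ) else 1) *
        rootUnit (q i) ^ (((a : ℕ) : ℤ) * (l'.toInt i - l.toInt i)))]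
  refine Finset.prod_eq_zero (Finset.mem_univ i) ?_
  simp only [if_neg hij, one_mul]
  exact hz i hi

theorem exists_cell_dvd (hq : ∀ j, 0 < q j) (n : Fin d → ℤ) :
    ∃ w : Cell q, ∀ j, (q j : ℤ) ∣ n j - w.toInt j := by
  have hqz : ∀ j, (0 : ℤ) < q j := fun j => by exact_mod_cast hq j
  refine ⟨fun j => ⟨(n j % q j).toNat, ?_⟩, fun j => ?_⟩
  · have h1 := Int.emod_nonneg (n j) (hqz j).ne'
    have h2 := Int.emod_lt_of_pos (n j) (hqz j)
    omega
  · simp only [Cell.toInt]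
    rw [Int.toNat_of_nonneg (Int.emod_nonneg (n j) (hqz j).ne')]
    exact Int.dvd_self_sub_emod

/-! ### The Floquet matrix in the basis of characters. -/

/-- The Bloch multipliers `exp (2πi xⱼ / qⱼ)`. -/
def multiplier (q : Fin d → ℕ) (x : Fin d → ℂ) (j : Fin d) : ℂ :=
  Complex.exp (2 * Real.pi * Complex.I * x j / q j)

/-- The eigenvalue of the Laplacian on `n ↦ wave q l n * ∏ zⱼ ^ nⱼ`. -/
def symbol (q : Fin d → ℕ) (z : Fin d → ℂ) (l : Cell q) : ℂ :=
  ∑ j, (z j * rootUnit (q j) ^ l.toInt j + (z j * rootUnit (q j) ^ l.toInt j)⁻¹)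

/-- The matrix of `Δ + V` in the basis `n ↦ wave q l n * ∏ zⱼ ^ nⱼ`. -/
def dualMatrix (q : Fin d → ℕ) (V : (Fin d → ℤ) → ℂ) (z : Fin d → ℂ) :
    Matrix (Cell q) (Cell q) ℂ :=
  Matrix.diagonal (symbol q z) + fourierKernel q V

theorem sum_blochBasis_mul (hq : ∀ j, 0 < q j) {k : Fin d → ℝ} {y : Fin d → ℂ}
    (hy0 : ∀ j, y j ≠ 0)
    (hy : ∀ j, y j ^ q j = Complex.exp (2 * Real.pi * Complex.I * k j)) (n : Fin d → ℤ) :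
    ∑ w : Cell q, blochBasis q k w n * ∏ j, y j ^ w.toInt j = ∏ j, y j ^ n j := by
  have hqz : ∀ j, (0 : ℤ) < q j := fun j => by exact_mod_cast hq j
  obtain ⟨w₀, hdvd⟩ := exists_cell_dvd hq n
  rw [Finset.sum_eq_single w₀]
  · rw [blochBasis, if_pos hdvd, Finset.mul_sum, Complex.exp_sum, ← Finset.prod_mul_distrib]
    refine Finset.prod_congr rfl fun j _ => ?_
    obtain ⟨c, hc⟩ := hdvd j
    rw [hc, Int.mul_ediv_cancel_left _ (hqz j).ne', ← mul_assoc, mul_comm _ (c : ℂ),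
      Complex.exp_int_mul, ← hy j, ← zpow_natCast, ← zpow_mul, ← zpow_add₀ (hy0 j), ← hc]
    congr 1
    ring
  · intro w _ hw
    rw [blochBasis, if_neg, zero_mul]
    intro h
    refine hw ((toInt_dvd_iff w w₀).mp fun j => ?_)
    have := dvd_sub (hdvd j) (h j)
    simpa using this
  · simp

theorem floquetDet_eq_det_dualMatrix (hq : ∀ j, 0 < q j) (V : (Fin d → ℤ) → ℂ) (k : Fin d → ℝ)
    (μ : ℂ) : floquetDet q V k μ =
      (dualMatrix q V (multiplier q fun j => (k j : ℂ)) - μ • 1).det := by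
  set z := multiplier q fun j => (k j : ℂ) with hz
  have hz0 : ∀ j, z j ≠ 0 := fun j => Complex.exp_ne_zero _
  let u : Cell q → (Fin d → ℤ) → ℂ := fun l n => ∏ j, (z j * rootUnit (q j) ^ l.toInt j) ^ n j
  have hy0 : ∀ (l : Cell q) j, z j * rootUnit (q j) ^ l.toInt j ≠ 0 := fun l j =>
    mul_ne_zero (hz0 j) (zpow_ne_zero _ (rootUnit_ne_zero _))
  have hu : ∀ l n, ∑ w : Cell q, blochBasis q k w n * u l w.toInt = u l n := by
    intro l n
    refine sum_blochBasis_mul hq (hy0 l) (fun j => ?_) n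
    rw [mul_pow, rootUnit_zpow_pow (hq j), mul_one, hz, multiplier, ← Complex.exp_nat_mul]
    congr 1
    have : (q j : ℂ) ≠ 0 := Nat.cast_ne_zero.mpr (hq j).ne'
    field_simp
  have hwave : ∀ l n, u l n = (∏ j, z j ^ n j) * wave q l n := by
    intro l n
    simp only [u, wave, ← Finset.prod_mul_distrib]
    refine Finset.prod_congr rfl fun j _ => ?_
    rw [mul_zpow, ← zpow_mul]
  have hshift : ∀ l n (j : Fin d) (c : ℤ), u l (n + Pi.single j c) =
      (z j * rootUnit (q j) ^ l.toInt j) ^ c * u l n := by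
    intro l n j c
    simp only [u, Pi.add_apply]
    simp only [zpow_add₀ (hy0 l _)]
    rw [Finset.prod_mul_distrib, mul_comm]
    congr 1
    rw [Finset.prod_eq_single j (fun i _ hi => by simp [hi]) (by simp), Pi.single_eq_same]
  have hlap : ∀ l n, laplacian (u l) n = symbol q z l * u l n := by
    intro l n
    simp only [laplacian, symbol, Finset.sum_mul]
    refine Finset.sum_congr rfl fun j _ => ?_
    rw [sub_eq_add_neg n, ← Pi.single_neg, hshift, hshift, zpow_one, zpow_neg, zpow_one, add_mul]
  let U : Matrix (Cell q) (Cell q) ℂ := Matrix.of fun w l => u l w.toInt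
  -- `U` is an invertible diagonal matrix times the character table, which is invertible by
  -- orthogonality.
  have hU : U.det ≠ 0 := by
    let W : Matrix (Cell q) (Cell q) ℂ := Matrix.of fun w l => wave q l w.toInt
    let W' : Matrix (Cell q) (Cell q) ℂ := Matrix.of fun l w => (wave q l w.toInt)⁻¹
    have hW : W * W' = (∏ j, (q j : ℂ)) • 1 := by
      ext w v
      simp only [W, W', Matrix.mul_apply, Matrix.of_apply, sum_wave_mul_inv hq, toInt_dvd_iff,
        Matrix.smul_apply, Matrix.one_apply, smul_eq_mul, mul_ite, mul_one, mul_zero]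
    have hW0 : W.det ≠ 0 := by
      have := congrArg Matrix.det hW
      rw [Matrix.det_mul, Matrix.det_smul, Matrix.det_one, mul_one] at this
      exact left_ne_zero_of_mul (this ▸ pow_ne_zero _ (prod_period_ne_zero hq))
    have hUW : U = Matrix.diagonal (fun w : Cell q => ∏ j, z j ^ w.toInt j) * W := by
      ext w l
      simp only [U, W, Matrix.diagonal_mul, Matrix.of_apply, hwave]
    rw [hUW, Matrix.det_mul, Matrix.det_diagonal]
    refine mul_ne_zero (Finset.prod_ne_zero_iff.mpr fun w _ => ?_) hW0
    exact Finset.prod_ne_zero_iff.mpr fun j _ => zpow_ne_zero _ (hz0 j)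
  have hint : floquetMatrix q V k * U = U * dualMatrix q V z := by
    ext w l
    have hl : (floquetMatrix q V k * U) w l = laplacian (u l) w.toInt + V w.toInt * u l w.toInt := by
      have : laplacian (u l) w.toInt =
          ∑ w', laplacian (blochBasis q k w') w.toInt * u l w'.toInt := by
        simp only [laplacian, Finset.sum_mul, add_mul]
        rw [Finset.sum_comm]
        refine Finset.sum_congr rfl fun j _ => ?_
        rw [Finset.sum_add_distrib, hu, hu]
      simp only [Matrix.mul_apply, floquetMatrix, Matrix.of_apply, U, add_mul,
        Finset.sum_add_distrib, mul_assoc, ← Finset.mul_sum, hu, this]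
    have hr : ∑ l', u l' w.toInt * fourierKernel q V l' l = V w.toInt * u l w.toInt := by
      simp only [hwave, mul_assoc, ← Finset.mul_sum, sum_wave_mul_fourierKernel hq]
      ring
    rw [hl, hlap, dualMatrix, mul_add, Matrix.add_apply, Matrix.mul_diagonal, Matrix.mul_apply]
    simp only [U, Matrix.of_apply, hr]
    ring
  have hfin : (floquetMatrix q V k - μ • (1 : Matrix (Cell q) (Cell q) ℂ)) * U =
      U * (dualMatrix q V z - μ • 1) := by
    rw [sub_mul, mul_sub, hint, Matrix.smul_mul, Matrix.mul_smul, one_mul, mul_one]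
  have := congrArg Matrix.det hfin
  rw [Matrix.det_mul, Matrix.det_mul, mul_comm] at this
  exact mul_left_cancel₀ hU this

theorem differentiable_det_dualMatrix (V : (Fin d → ℤ) → ℂ) (μ : ℂ) (x : Fin d → ℂ) (j : Fin d) :
    Differentiable ℂ fun w =>
      (dualMatrix q V (multiplier q (Function.update x j w)) - μ • 1).det := by
  have hx : ∀ i, Differentiable ℂ fun w : ℂ => Function.update x j w i := by
    intro i
    by_cases h : i = j
    · subst h; simp only [Function.update_self]; fun_prop
    · simp only [Function.update_of_ne h]; fun_prop
  have hm : ∀ i, Differentiable ℂ fun w : ℂ => multiplier q (Function.update x j w) i := by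
    intro i
    have := hx i
    simp only [multiplier]
    fun_prop
  have hs : ∀ l, Differentiable ℂ fun w : ℂ => symbol q (multiplier q (Function.update x j w)) l := by
    intro l
    simp only [symbol]
    refine Differentiable.fun_sum fun i _ => ?_
    have h1 := (hm i).mul_const (rootUnit (q i) ^ l.toInt i)
    exact h1.add (h1.inv fun w => mul_ne_zero (Complex.exp_ne_zero _)
      (zpow_ne_zero _ (rootUnit_ne_zero _)))
  simp only [Matrix.det_apply']
  refine Differentiable.fun_sum fun σ _ => Differentiable.const_mul ?_ _
  refine Differentiable.fun_finsetProd fun i _ => ?_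
  simp only [dualMatrix, Matrix.sub_apply, Matrix.add_apply, Matrix.diagonal_apply]
  split_ifs
  · exact ((hs _).add_const _).sub_const _
  · fun_prop

/-! ### Asymptotics along a ray of multipliers. -/

/-- The leading coefficient of `symbol q (τ z + u) l` as `τ → ∞`. -/
def leadingSymbol (q : Fin d → ℕ) (z : Fin d → ℂ) (l : Cell q) : ℂ :=
  ∑ j, z j * rootUnit (q j) ^ l.toInt j

/-- The constant coefficient of `symbol q (τ z + u) l` as `τ → ∞`. -/
def constantSymbol (q : Fin d → ℕ) (z u : Fin d → ℂ) (l : Cell q) : ℂ :=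
  ∑ j, (u j * rootUnit (q j) ^ l.toInt j +
    if z j = 0 then (u j * rootUnit (q j) ^ l.toInt j)⁻¹ else 0)

/-- The inverse multipliers die in the directions that escape to infinity and survive where `z j =
0`. -/
theorem tendsto_symbol_sub (z u : Fin d → ℂ) (l : Cell q) :
    Tendsto (fun τ : ℝ => symbol q (fun j => τ * z j + u j) l - τ * leadingSymbol q z l) atTop
      (𝓝 (constantSymbol q z u l)) := by
  have h : ∀ τ : ℝ, symbol q (fun j => τ * z j + u j) l - τ * leadingSymbol q z l =
      ∑ j, (u j * rootUnit (q j) ^ l.toInt j +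
        ((τ * z j + u j) * rootUnit (q j) ^ l.toInt j)⁻¹) := by
    intro τ
    rw [symbol, leadingSymbol, Finset.mul_sum, ← Finset.sum_sub_distrib]
    refine Finset.sum_congr rfl fun j _ => ?_
    ring
  simp only [h, constantSymbol]
  refine tendsto_finsetSum _ fun j _ => tendsto_const_nhds.add ?_
  split_ifs with hz
  · simp only [hz, mul_zero, zero_add]
    exact tendsto_const_nhds
  · refine tendsto_inv₀_cobounded.comp ?_
    have hω : rootUnit (q j) ^ l.toInt j ≠ 0 := zpow_ne_zero _ (rootUnit_ne_zero _)
    rw [← tendsto_norm_atTop_iff_cobounded]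
    have h1 : Tendsto (fun τ : ℝ => ‖τ‖ * ‖z j * rootUnit (q j) ^ l.toInt j‖ -
        ‖u j * rootUnit (q j) ^ l.toInt j‖) atTop atTop :=
      tendsto_atTop_add_const_right _ _ (tendsto_norm_atTop_atTop.atTop_mul_const
        (norm_pos_iff.mpr (mul_ne_zero hz hω)))
    refine tendsto_atTop_mono (fun τ => ?_) h1
    have h2 := norm_sub_norm_le ((τ : ℂ) * (z j * rootUnit (q j) ^ l.toInt j))
      (-(u j * rootUnit (q j) ^ l.toInt j))
    rw [norm_neg, norm_mul, Complex.norm_real] at h2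
    refine h2.trans (le_of_eq (congrArg _ ?_))
    ring

theorem tendsto_symbol_div (z u : Fin d → ℂ) (l : Cell q) :
    Tendsto (fun τ : ℝ => (τ : ℂ)⁻¹ * symbol q (fun j => τ * z j + u j) l) atTop
      (𝓝 (leadingSymbol q z l)) := by
  have hinv : Tendsto (fun τ : ℝ => (τ : ℂ)⁻¹) atTop (𝓝 0) := by
    have := (Complex.continuous_ofReal.tendsto 0).comp tendsto_inv_atTop_zero
    simpa [Function.comp_def] using this
  have h := (hinv.mul (tendsto_symbol_sub z u l)).add_const (leadingSymbol q z l)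
  rw [zero_mul, zero_add] at h
  refine h.congr' ?_
  filter_upwards [eventually_gt_atTop 0] with τ hτ
  have : (τ : ℂ) ≠ 0 := Complex.ofReal_ne_zero.mpr hτ.ne'
  field_simp
  ring

/-- The leading term of the characteristic determinant along a ray on which the symbols of the
indices in `a` and `b` stay bounded. -/
theorem tendsto_det_dualMatrix (V : (Fin d → ℤ) → ℂ) (μ : ℂ) {z u : Fin d → ℂ}
    {a b : Cell q → Prop} [DecidablePred a] [DecidablePred b] {α β : ℂ} {c : Cell q → ℂ}
    (ha : ∀ l, a l → leadingSymbol q z l = 0 ∧ constantSymbol q z u l = α + c l)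
    (hb : ∀ l, b l → leadingSymbol q z l = 0 ∧ constantSymbol q z u l = β + c l) :
    Tendsto (fun τ : ℝ => (∏ l : Cell q, if a l ∨ b l then 1 else (τ : ℂ)⁻¹) *
        (dualMatrix q V (fun j => τ * z j + u j) - μ • 1).det) atTop
      (𝓝 (twoBlockMatrix a b (leadingSymbol q z) (fun l => c l - μ) (fourierKernel q V)
        α β).det) := by
  -- The scalar factors are absorbed into the rows, so that the limit can be taken entrywise.
  simp only [← Matrix.det_mul_column]
  refine (Continuous.matrix_det continuous_id).continuousAt.tendsto.comp
    (tendsto_pi_nhds.mpr fun l => tendsto_pi_nhds.mpr fun l' => ?_)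
  have hinv : Tendsto (fun τ : ℝ => (τ : ℂ)⁻¹) atTop (𝓝 0) := by
    have := (Complex.continuous_ofReal.tendsto 0).comp tendsto_inv_atTop_zero
    simpa [Function.comp_def] using this
  have hbdd : leadingSymbol q z l = 0 → Tendsto (fun τ : ℝ => symbol q (fun j => τ * z j + u j) l)
      atTop (𝓝 (constantSymbol q z u l)) := by
    intro h
    simpa [h] using tendsto_symbol_sub z u l
  have hblock : ∀ δ : ℂ, leadingSymbol q z l = 0 ∧ constantSymbol q z u l = δ + c l →
      Tendsto (fun τ : ℝ => (dualMatrix q V (fun j => τ * z j + u j) - μ • 1) l l') atTop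
        (𝓝 ((if l = l' then δ + (c l - μ) else 0) + fourierKernel q V l l')) := by
    rintro δ ⟨h0, hδ⟩
    by_cases hl : l = l'
    · subst hl
      simp only [dualMatrix, Matrix.sub_apply, Matrix.add_apply, Matrix.diagonal_apply_eq,
        Matrix.smul_apply, Matrix.one_apply_eq, smul_eq_mul, mul_one, if_true]
      have := ((hbdd h0).add_const (fourierKernel q V l l)).sub_const μ
      rw [hδ] at this
      convert this using 2
      ring
    · simp [dualMatrix, hl]
  by_cases hal : a l
  · simpa [twoBlockMatrix, hal] using hblock α (ha l hal)
  by_cases hbl : b l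
  · simpa [twoBlockMatrix, hal, hbl] using hblock β (hb l hbl)
  simp only [Matrix.of_apply, hal, hbl, or_self, if_false]
  by_cases hl : l = l'
  · subst hl
    simp only [dualMatrix, Matrix.sub_apply, Matrix.add_apply, Matrix.diagonal_apply_eq,
      Matrix.smul_apply, Matrix.one_apply_eq, smul_eq_mul, mul_one, if_true]
    have := (tendsto_symbol_div z u l).add (hinv.mul_const (fourierKernel q V l l - μ))
    rw [zero_mul, add_zero] at this
    refine this.congr fun τ => ?_
    ring
  · simp only [dualMatrix, Matrix.sub_apply, Matrix.add_apply, Matrix.diagonal_apply_ne _ hl,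
      Matrix.smul_apply, Matrix.one_apply_ne hl, smul_zero, sub_zero, zero_add, if_neg hl]
    simpa using hinv.mul_const (fourierKernel q V l l')

/-! ### Vanishing of the mixed Fourier coefficients. -/

/-- If the characteristic determinants of `V` and `Y` agree for three free multipliers, and `V` is
completely separable, then the Fourier coefficient of `Y` at `l` vanishes as soon as `l` is nonzero
in two of the three directions. -/
theorem fourierKernel_eq_zero_of_det_eq (hq : ∀ j, 0 < q j)
    (hcop : Pairwise fun i j => Nat.Coprime (q i) (q j)) {V Y : (Fin d → ℤ) → ℂ}
    (hYreal : ∀ n, (Y n).im = 0) (hVsep : IsCompletelySeparable V) {s t r : Fin d} (hst : s ≠ t)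
    (hrs : r ≠ s) (hrt : r ≠ t) {ζ : Fin d → ℂ} (hζ : ∀ j, ζ j ≠ 0) {μ₁ μ₂ : ℂ}
    (h : ∀ z : Fin d → ℂ, (∀ j, z j ≠ 0) → (∀ j, j ≠ s → j ≠ t → j ≠ r → z j = ζ j) →
      (dualMatrix q V z - μ₁ • 1).det = (dualMatrix q Y z - μ₂ • 1).det)
    {o l : Cell q} (ho : ∀ j, o.toInt j = 0) (hls : l s ≠ o s) (hlt : l t ≠ o t) :
    fourierKernel q Y o l = 0 := by
  classical
  have hω : ∀ (n : Cell q) j, (rootUnit (q j) ^ n.toInt j) ^ q j = 1 :=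
    fun n j => rootUnit_zpow_pow (hq j) _
  have hinj : ∀ (n m : Cell q) j, rootUnit (q j) ^ n.toInt j = rootUnit (q j) ^ m.toInt j →
      n j = m j := by
    intro n m j e
    rw [← dvd_toInt_sub_iff, ← (isPrimitiveRoot_rootUnit (hq j)).zpow_eq_one_iff_dvd,
      zpow_sub₀ (rootUnit_ne_zero _), e, div_self (zpow_ne_zero _ (rootUnit_ne_zero _))]
  have ho1 : ∀ j, rootUnit (q j) ^ o.toInt j = 1 := fun j => by rw [ho, zpow_zero]
  obtain ⟨x, hx⟩ : ∃ x : Fin d → ℂ, ∀ j, x j = rootUnit (q j) ^ l.toInt j := ⟨_, fun _ => rfl⟩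
  -- A common value would be a root of unity of two coprime orders, hence `1`. Only one of the two
  -- coordinates of `l` has to be nonzero, so `l r` is arbitrary.
  have hne1 : ∀ {i j : Fin d}, i ≠ j → l i ≠ o i → x i ≠ x j := by
    intro i j hij hi e
    refine hi (hinj l o i ?_)
    rw [ho1, ← hx]
    refine eq_one_of_pow_eq_one_of_coprime (hcop hij) ?_ ?_
    · rw [hx, hω]
    · rw [e, hx, hω]
  have xst : x s ≠ x t := hne1 hst hls
  have xsr : x s ≠ x r := hne1 hrs.symm hls
  have xtr : x t ≠ x r := hne1 hrt.symm hlt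
  have hxts : x t - x s ≠ 0 := sub_ne_zero.mpr xst.symm
  let R : Finset (Fin d) := ((Finset.univ.erase s).erase t).erase r
  have hR : ∀ {j}, j ∈ R → j ≠ s ∧ j ≠ t ∧ j ≠ r := by
    intro j hj
    simp only [R, Finset.mem_erase] at hj
    exact ⟨hj.2.2.1, hj.2.1, hj.1⟩
  have hsum : ∀ f : Fin d → ℂ, ∑ j, f j = f s + f t + f r + ∑ j ∈ R, f j := by
    intro f
    rw [← Finset.add_sum_erase _ f (Finset.mem_univ s),
      ← Finset.add_sum_erase _ f (show t ∈ Finset.univ.erase s by simp [hst.symm]),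
      ← Finset.add_sum_erase _ f (show r ∈ (Finset.univ.erase s).erase t by simp [hrs, hrt])]
    ring
  -- The cross product of `(1, 1, 1)` and `(x s, x t, x r)`, up to sign, and `0` in the frozen
  -- directions.
  let z : Fin d → ℂ := fun j =>
    if j = s then x r - x t else if j = t then x s - x r else if j = r then x t - x s else 0
  have zs : z s = x r - x t := by simp [z]
  have zt : z t = x s - x r := by simp [z, hst.symm]
  have zr : z r = x t - x s := by simp [z, hrs, hrt]
  have zR : ∀ {j}, j ∈ R → z j = 0 := fun hj => by simp [z, hR hj]
  -- The solution of `u s + u t = α`, `x s * u s + x t * u t = β`; the frozen directions keep their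
  -- multipliers `ζ`.
  let u : ℂ → ℂ → Fin d → ℂ := fun α β j =>
    if j = s then α - (β - x s * α) / (x t - x s) else
      if j = t then (β - x s * α) / (x t - x s) else if j = r then 0 else ζ j
  have us : ∀ α β, u α β s = α - (β - x s * α) / (x t - x s) := fun α β => by simp [u]
  have ut : ∀ α β, u α β t = (β - x s * α) / (x t - x s) := fun α β => by simp [u, hst.symm]
  have ur : ∀ α β, u α β r = 0 := fun α β => by simp [u, hrs, hrt]
  have uR : ∀ α β {j}, j ∈ R → u α β j = ζ j := fun α β j hj => by simp [u, hR hj]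
  have zs0 : z s ≠ 0 := zs ▸ sub_ne_zero.mpr xtr.symm
  have zt0 : z t ≠ 0 := zt ▸ sub_ne_zero.mpr xsr
  have zr0 : z r ≠ 0 := zr ▸ hxts
  let a : Cell q → Prop := fun n => n s = o s ∧ n t = o t ∧ n r = o r
  let b : Cell q → Prop := fun n => n s = l s ∧ n t = l t ∧ n r = l r
  let c : Cell q → ℂ := fun n =>
    ∑ j ∈ R, (ζ j * rootUnit (q j) ^ n.toInt j + (ζ j * rootUnit (q j) ^ n.toInt j)⁻¹)
  have hlead : ∀ n : Cell q, leadingSymbol q z n = rootUnit (q s) ^ n.toInt s * (x r - x t) +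
      rootUnit (q t) ^ n.toInt t * (x s - x r) + rootUnit (q r) ^ n.toInt r * (x t - x s) := by
    intro n
    rw [leadingSymbol, hsum, zs, zt, zr,
      Finset.sum_eq_zero fun j hj => by rw [zR hj, zero_mul]]
    ring
  have hconst : ∀ α β (n : Cell q), constantSymbol q z (u α β) n =
      u α β s * rootUnit (q s) ^ n.toInt s + u α β t * rootUnit (q t) ^ n.toInt t + c n := by
    intro α β n
    rw [constantSymbol, hsum, if_neg zs0, if_neg zt0, if_neg zr0, ur]
    rw [Finset.sum_congr rfl fun j hj => by rw [uR α β hj, if_pos (zR hj)]]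
    ring
  have hval : ∀ {n m : Cell q} {j}, n j = m j → n.toInt j = m.toInt j := fun h => by
    simp only [Cell.toInt, h]
  have ha : ∀ α β n, a n → leadingSymbol q z n = 0 ∧ constantSymbol q z (u α β) n = α + c n := by
    rintro α β n ⟨e1, e2, e3⟩
    rw [hlead, hconst, hval e1, hval e2, hval e3, ho1, ho1, ho1, us, ut]
    exact ⟨by ring, by ring⟩
  have hb : ∀ α β n, b n → leadingSymbol q z n = 0 ∧ constantSymbol q z (u α β) n = β + c n := by
    rintro α β n ⟨e1, e2, e3⟩
    rw [hlead, hconst, hval e1, hval e2, hval e3, ← hx, ← hx, ← hx, us, ut]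
    refine ⟨by ring, ?_⟩
    field_simp
    ring
  have hγ : ∀ n, ¬ a n → ¬ b n → leadingSymbol q z n ≠ 0 := by
    intro n hna hnb h0
    rw [hlead] at h0
    rcases eq_one_or_eq_of_collinear_roots (hq s) (hq t) (hq r) (hcop hst)
      (by rw [hx, hω]) (by rw [hx, hω]) (by rw [hx, hω]) (hω n s) (hω n t) (hω n r) xst xsr xtr h0
      with ⟨e1, e2, e3⟩ | ⟨e1, e2, e3⟩
    · exact hna ⟨hinj _ _ _ (e1.trans (ho1 s).symm), hinj _ _ _ (e2.trans (ho1 t).symm),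
        hinj _ _ _ (e3.trans (ho1 r).symm)⟩
    · exact hnb ⟨hinj _ _ _ (e1.trans (hx s)), hinj _ _ _ (e2.trans (hx t)),
        hinj _ _ _ (e3.trans (hx r))⟩
  have hdet : ∀ α β,
      (twoBlockMatrix a b (leadingSymbol q z) (fun n => c n - μ₂) (fourierKernel q Y) α β).det =
      (twoBlockMatrix a b (leadingSymbol q z) (fun n => c n - μ₁) (fourierKernel q V) α β).det := by
    intro α β
    refine tendsto_nhds_unique (tendsto_det_dualMatrix Y μ₂ (ha α β) (hb α β))
      ((tendsto_det_dualMatrix V μ₁ (ha α β) (hb α β)).congr' ?_)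
    -- The hypothesis needs nonzero multipliers; each moving coordinate vanishes for at most one
    -- `τ`.
    have hev : ∀ᶠ τ : ℝ in atTop, ∀ j, (τ : ℂ) * z j + u α β j ≠ 0 := by
      refine eventually_all.mpr fun j => ?_
      by_cases hz : z j = 0
      · have hj : j ≠ s ∧ j ≠ t ∧ j ≠ r :=
          ⟨fun e => zs0 (e ▸ hz), fun e => zt0 (e ▸ hz), fun e => zr0 (e ▸ hz)⟩
        refine Eventually.of_forall fun τ => ?_
        simpa [hz, u, hj] using hζ j
      · filter_upwards [eventually_ne_atTop (-(u α β j) / z j).re] with τ hτ e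
        refine hτ ?_
        rw [← eq_neg_of_add_eq_zero_left e, mul_div_cancel_right₀ _ hz, Complex.ofReal_re]
    filter_upwards [hev] with τ hτ
    rw [h _ hτ fun j h1 h2 h3 => by simp [z, u, h1, h2, h3]]
  exact eq_zero_of_det_twoBlockMatrix_eq (a := a) (b := b)
    (fun n h1 h2 => hls (h2.1.symm.trans h1.1)) hγ (fourierKernel_isHermitian hq hYreal)
    (fun n m h1 h2 => hVsep.fourierKernel_eq_zero hq hst
      (fun e => hls (h2.1.symm.trans (e.symm.trans h1.1)))
      (fun e => hlt (h2.2.1.symm.trans (e.symm.trans h1.2.1))))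
    (fun n m h1 h2 => hVsep.fourierKernel_eq_zero hq hst
      (fun e => hls (h1.1.symm.trans (e.trans h2.1)))
      (fun e => hlt (h1.2.1.symm.trans (e.trans h2.2.1))))
    hdet ⟨rfl, rfl, rfl⟩ ⟨rfl, rfl, rfl⟩

/-- Generalized partial Fermi isospectrality extends to complex multipliers. -/
theorem GenPartiallyFermiIsospectral.exists_det_dualMatrix_eq (hq : ∀ j, 0 < q j)
    {S : Finset (Fin d)} {V Y : (Fin d → ℤ) → ℂ} (h : GenPartiallyFermiIsospectral q S V Y) :
    ∃ (μ₁ μ₂ : ℂ) (ζ : Fin d → ℂ), (∀ j, ζ j ≠ 0) ∧ ∀ z : Fin d → ℂ, (∀ j, z j ≠ 0) →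
      (∀ j, j ∉ S → z j = ζ j) →
      (dualMatrix q V z - μ₁ • 1).det = (dualMatrix q Y z - μ₂ • 1).det := by
  obtain ⟨-, μ₁, μ₂, κ, hk⟩ := h
  refine ⟨μ₁, μ₂, multiplier q fun j => (κ j : ℂ), fun j => Complex.exp_ne_zero _, ?_⟩
  intro z hz hzS
  -- A logarithm turns any nonzero multiplier into a complex quasimomentum.
  let x : Fin d → ℂ := fun j =>
    if j ∈ S then q j * Complex.log (z j) / (2 * Real.pi * Complex.I) else κ j
  have hxz : multiplier q x = z := by
    funext j
    by_cases hj : j ∈ S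
    · have h1 : (q j : ℂ) ≠ 0 := Nat.cast_ne_zero.mpr (hq j).ne'
      have h2 : (Real.pi : ℂ) ≠ 0 := Complex.ofReal_ne_zero.mpr Real.pi_ne_zero
      have h3 : 2 * Real.pi * Complex.I * x j / q j = Complex.log (z j) := by
        simp only [x, if_pos hj]
        field_simp
      rw [multiplier, h3, Complex.exp_log (hz j)]
    · rw [hzS j hj, multiplier, multiplier]
      simp only [x, if_neg hj]
  have := eq_zero_of_eq_zero_on_real S (fun x => (dualMatrix q V (multiplier q x) - μ₁ • 1).det -
      (dualMatrix q Y (multiplier q x) - μ₂ • 1).det)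
    (fun x j => (differentiable_det_dualMatrix V μ₁ x j).sub
      (differentiable_det_dualMatrix Y μ₂ x j)) κ
    (fun k hkS => by
      rw [← floquetDet_eq_det_dualMatrix hq, ← floquetDet_eq_det_dualMatrix hq, hk k hkS, sub_self])
    x (fun j hj => by simp only [x, if_neg hj])
  rw [hxz] at this
  exact sub_eq_zero.mp this

/-! ### Fourier series and separability. -/

theorem IsPeriodic.eq_of_dvd {Y : (Fin d → ℤ) → ℂ} (hY : IsPeriodic q Y) {n m : Fin d → ℤ}
    (h : ∀ j, (q j : ℤ) ∣ n j - m j) : Y n = Y m := by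
  choose c hc using h
  have hper : Function.Periodic Y (∑ j, c j • Pi.single j (q j : ℤ)) :=
    Finset.sum_induction _ (Function.Periodic Y) (fun _ _ h1 h2 => h1.add_period h2)
      (fun n => by rw [add_zero]) fun j _ => Function.Periodic.zsmul (fun n => hY n j) (c j)
  rw [← hper m]
  congr 1
  funext i
  rw [Pi.add_apply, Finset.sum_apply, Finset.sum_eq_single i
    (fun j _ hj => by simp [hj.symm]) (by simp)]
  have := hc i
  simp only [Pi.smul_apply, Pi.single_eq_same, smul_eq_mul]
  linarith

theorem wave_eq_of_dvd (hq : ∀ j, 0 < q j) (l : Cell q) {n m : Fin d → ℤ}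
    (h : ∀ j, (q j : ℤ) ∣ n j - m j) : wave q l n = wave q l m := by
  refine Finset.prod_congr rfl fun j _ => ?_
  obtain ⟨c, hc⟩ := h j
  rw [show n j = m j + q j * c by linarith, mul_add, zpow_add₀ (rootUnit_ne_zero _),
    mul_left_comm, zpow_mul _ (q j : ℤ), zpow_natCast,
    (isPrimitiveRoot_rootUnit (hq j)).pow_eq_one, one_zpow, mul_one]

/-- A periodic function is the sum of its Fourier series. -/
theorem IsPeriodic.eq_sum_wave (hq : ∀ j, 0 < q j) {Y : (Fin d → ℤ) → ℂ} (hY : IsPeriodic q Y)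
    {o : Cell q} (ho : ∀ j, o.toInt j = 0) (n : Fin d → ℤ) :
    Y n = ∑ l, wave q l n * fourierKernel q Y l o := by
  obtain ⟨w, hw⟩ := exists_cell_dvd hq n
  simp only [wave_eq_of_dvd hq _ hw]
  rw [hY.eq_of_dvd hw, sum_wave_mul_fourierKernel hq, show wave q o w.toInt = 1 by simp [wave, ho],
    mul_one]

theorem isCompletelySeparable_sum {ι : Type*} {A : Finset ι} {f : ι → (Fin d → ℤ) → ℂ}
    (h : ∀ i, IsCompletelySeparable (f i)) : IsCompletelySeparable fun n => ∑ i ∈ A, f i n := by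
  choose v hv using h
  refine ⟨fun j m => ∑ i ∈ A, v i j m, fun n => ?_⟩
  simp only [hv]
  exact Finset.sum_comm

theorem isCompletelySeparable_single (j : Fin d) (g : ℤ → ℂ) :
    IsCompletelySeparable fun n : Fin d → ℤ => g (n j) :=
  ⟨fun i m => if i = j then g m else 0, fun n => by simp⟩

end DiscreteSchrodinger

end

open DiscreteSchrodinger in
theorem mainTheorem6 (d : ℕ) (hd : 3 ≤ d) (q : Fin d → ℕ) (hq : ∀ j, 0 < q j)
    (hcop : Pairwise fun i j => Nat.Coprime (q i) (q j))
    (V Y : (Fin d → ℤ) → ℂ)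
    (hVreal : ∀ n, (V n).im = 0) (hYreal : ∀ n, (Y n).im = 0)
    (hVper : DiscreteSchrodinger.IsPeriodic q V) (hYper : DiscreteSchrodinger.IsPeriodic q Y)
    (hVsep : DiscreteSchrodinger.IsCompletelySeparable V)
    (hiso : ∀ s t : Fin d, s < t → ∃ S : Finset (Fin d), s ∈ S ∧ t ∈ S ∧ 3 ≤ S.card ∧
      DiscreteSchrodinger.GenPartiallyFermiIsospectral q S V Y) :
    DiscreteSchrodinger.IsCompletelySeparable Y := by
  let o : Cell q := fun j => ⟨0, hq j⟩
  have ho : ∀ j, o.toInt j = 0 := fun j => rfl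
  have hzero : ∀ (l : Cell q) s t, s < t → l s ≠ o s → l t ≠ o t → fourierKernel q Y l o = 0 := by
    intro l s t hst hls hlt
    obtain ⟨S, hs, ht, hcard, hS⟩ := hiso s t hst
    obtain ⟨r, hr, hrst⟩ : ∃ r ∈ S, r ∉ ({s, t} : Finset (Fin d)) :=
      Finset.exists_mem_notMem_of_card_lt_card (lt_of_le_of_lt Finset.card_le_two hcard)
    simp only [Finset.mem_insert, Finset.mem_singleton, not_or] at hrst
    obtain ⟨μ₁, μ₂, ζ, hζ, hdet⟩ := hS.exists_det_dualMatrix_eq hq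
    rw [← fourierKernel_isHermitian hq hYreal, fourierKernel_eq_zero_of_det_eq hq hcop hYreal hVsep
      hst.ne hrst.1 hrst.2 hζ (fun z hz hz' => hdet z hz fun j hj => hz' j
        (fun e => hj (e ▸ hs)) (fun e => hj (e ▸ ht)) (fun e => hj (e ▸ hr))) ho hls hlt, star_zero]
  rw [funext (hYper.eq_sum_wave hq ho)]
  refine isCompletelySeparable_sum fun l => ?_
  -- Each term of the Fourier series either has zero coefficient or a frequency on the axis of a
  -- single `j`; for `l = o` any `j` serves.
  obtain ⟨j, hj⟩ : ∃ j, fourierKernel q Y l o = 0 ∨ ∀ i, i ≠ j → l i = o i := by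
    by_cases h : ∃ j, l j ≠ o j
    · obtain ⟨j, hj⟩ := h
      refine ⟨j, or_iff_not_imp_left.mpr fun hne i hij => ?_⟩
      by_contra hi
      rcases lt_or_gt_of_ne hij with hlt | hlt
      · exact hne (hzero l i j hlt hi hj)
      · exact hne (hzero l j i hlt hj hi)
    · push Not at h
      exact ⟨⟨0, by omega⟩, Or.inr fun i _ => h i⟩
  rcases hj with h0 | hj
  · refine ⟨0, fun n => ?_⟩
    simp [h0]
  · have hw : ∀ n, wave q l n = rootUnit (q j) ^ (l.toInt j * n j) := fun n =>
      Finset.prod_eq_single j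
        (fun i _ hi => by rw [show l.toInt i = 0 by simp [Cell.toInt, hj i hi, o], zero_mul,
          zpow_zero]) (by simp)
    simp only [hw]
    exact isCompletelySeparable_single j fun m =>
      rootUnit (q j) ^ (l.toInt j * m) * fourierKernel q Y l o
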